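/- All graphs are finite and may have loops and multiple edges. A graph $G$ \emph{contains an immersion of} $K_t$ if there are an injective map $\phi:V(K_t)\to V(G)$ and, for each edge $uv$ of $K_t$, a path $P_{uv}$ in $G$ joining $\phi(u)$ and $\phi(v)$, such that the paths $P_{uv}$ are pairwise edge-disjoint. For $X\subseteq V(G)$ let $\delta(X)$ be the edge-cut consisting of all edges of $G$ between $X$ and $V(G)\setminus X$; it comes with the vertex bipartition $\{X,V(G)\setminus X\}$, and it separates $x$ and $y$ if exactly one of them lies in $X$. Two edge-cuts $\delta(X)$ and $\delta(Y)$ are \emph{uncrossed} if, for the vertex set $C$ of each connected component of $G$, one of $X\cap C$, $C\setminus X$ is contained in one of $Y\cap C$, $C\setminus Y$. A family of pairwise uncrossed edge-cuts is \emph{laminar}; the resulting vertex partition is the partition of $V(G)$ in which two vertices lie in the same block if and only if no cut of the family separates them. \textbf{Theorem.} Let $t$ be a natural number and let $G$ be a graph that does not contain an immersion of the complete graph $K_t$. Then there is a laminar family of edge-cuts of $G$, each of size less than $(t-1)^2$, such that every block of the resulting vertex partition has fewer than $t$ vertices. -/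

import Mathlib

open scoped Graph

namespace Graph

/-- Walks in a multigraph, recorded together with the edges that they use. -/
inductive Walk {α β : Type*} (G : Graph α β) : α → α → Type _
  | nil {x : α} (hx : x ∈ V(G)) : Walk G x x
  | cons {x y z : α} (e : β) (h : G.IsLink e x y) (w : Walk G y z) : Walk G x z

/-- The vertices visited by a walk, in order. -/
def Walk.support {α β : Type*} {G : Graph α β} : {x y : α} → G.Walk x y → List α
  | x, _, .nil _ => [x]
  | x, _, .cons _ _ w => x :: w.support

/-- The edges traversed by a walk, in order. -/
def Walk.edges {α β : Type*} {G : Graph α β} : {x y : α} → G.Walk x y → List β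
  | _, _, .nil _ => []
  | _, _, .cons e _ w => e :: w.edges

/-- A path is a walk without repeated vertices. -/
def Walk.IsPath {α β : Type*} {G : Graph α β} {x y : α} (w : G.Walk x y) : Prop :=
  w.support.Nodup

/-- `S` is the set of edges of a path of `G` joining `x` and `y`. -/
def IsPathEdgeSet {α β : Type*} (G : Graph α β) (x y : α) (S : Set β) : Prop :=
  ∃ w : G.Walk x y, w.IsPath ∧ S = {f | f ∈ w.edges}

/-- `G` has an `H`-immersion: there are an injective map `φ` from the vertices of `H` to the
vertices of `G` and, for every edge `uv` of `H`, a path `P uv` of `G` joining `φ u` and `φ v`,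
such that these paths are pairwise edge-disjoint. -/
def HasImmersion {α β γ : Type*} (G : Graph α β) (H : SimpleGraph γ) : Prop :=
  ∃ φ : γ → α, Function.Injective φ ∧ (∀ v, φ v ∈ V(G)) ∧
    ∃ P : Sym2 γ → Set β,
      (∀ u v, H.Adj u v → G.IsPathEdgeSet (φ u) (φ v) (P s(u, v))) ∧
      H.edgeSet.PairwiseDisjoint P

/-- The edge-cut `δ(X)`: all edges between `X` and `V(G) \ X`. -/
def edgeCut {α β : Type*} (G : Graph α β) (X : Set α) : Set β :=
  {e | ∃ x ∈ X, ∃ y ∈ V(G) \ X, G.IsLink e x y}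

/-- The vertex set of the component of `G` that contains `x`. -/
def componentOf {α β : Type*} (G : Graph α β) (x : α) : Set α :=
  {y | Nonempty (G.Walk x y)}

/-- The edge-cuts `δ(X)` and `δ(Y)` are uncrossed: in each component, with vertex set `C`, one of
the two sides `X ∩ C`, `C \ X` is contained in one of the two sides `Y ∩ C`, `C \ Y`. -/
def Uncrossed {α β : Type*} (G : Graph α β) (X Y : Set α) : Prop :=
  ∀ c ∈ V(G),
    X ∩ G.componentOf c ⊆ Y ∩ G.componentOf c ∨
    X ∩ G.componentOf c ⊆ G.componentOf c \ Y ∨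
    G.componentOf c \ X ⊆ Y ∩ G.componentOf c ∨
    G.componentOf c \ X ⊆ G.componentOf c \ Y

/-- A laminar family of edge-cuts. A cut `δ(X)` is represented by one of its sides `X ⊆ V(G)`, so
that the bipartition `{X, V(G) \ X}` is known also when `G` is disconnected. -/
def IsLaminarCutFamily {α β : Type*} (G : Graph α β) (F : Set (Set α)) : Prop :=
  (∀ X ∈ F, X ⊆ V(G)) ∧ F.Pairwise G.Uncrossed

/-- The blocks of the partition of `V(G)` induced by the family of cuts `δ(X)`, `X ∈ F`: two
vertices are in the same block if and only if no cut of the family separates them. -/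
def cutBlocks {α β : Type*} (G : Graph α β) (F : Set (Set α)) : Set (Set α) :=
  {B | ∃ x ∈ V(G), B = {y | y ∈ V(G) ∧ ∀ X ∈ F, (x ∈ X ↔ y ∈ X)}}

end Graph

/-!
A set of vertices no two of which are separated by a cut of size less than `(t - 1) ^ 2` has fewer
than `t` elements when there is no immersion of `K_t`; so it suffices to find a laminar family of
cuts of size less than `k = (t - 1) ^ 2` separating any two vertices that some cut of size less
than `k` separates.

Such a family is what the light edges of a Gomory–Hu tree provide. It is obtained here without the
tree, as a maximal nested family of cuts of size less than `k`, each a minimum cut for some pair of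
vertices (`Graph.exists_nested_family`). If such a family left `u` and `v` unseparated, the
uncrossing argument of Gomory and Hu would turn a minimum `u`-`v` cut into one nested with all
members.

Conversely, let `φ 0, …, φ (t - 1)` be pairwise not separated by cuts of size less than
`(t - 1) ^ 2`, and fix one of them as a root. A cut between the root and some other `φ i` is large
enough to satisfy `t - 1` demands at every non-root `φ i`, so Menger's theorem
(`Graph.exists_disjoint_connections`) yields edge-disjoint paths `Q (i, j)`, `j ≠ i`, from the root
to `φ i`. The union of `Q (i, j)` and `Q (j, i)` contains a path between `φ i` and `φ j`, and these
unions are disjoint (`Graph.hasImmersion_top`).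

Menger's theorem is proved for digraphs by splitting off the last arc of a walk
(`ArcMenger.exists_disjoint_walks`). Passing to undirected graphs uses that a minimal set of arcs
satisfying the cut condition contains no edge in both directions
(`ArcMenger.not_antiparallel_of_minimal`).
-/

/-! ### Edge-disjoint paths from a root in a digraph -/

namespace ArcMenger

variable {α β ι : Type*} [Fintype ι]

open scoped Classical in
/-- The arcs of `S` that leave the vertex set `X`. -/
noncomputable def outArcs (tl hd : β → α) (S : Finset β) (X : Set α) : Finset β :=
  S.filter fun e => tl e ∈ X ∧ hd e ∉ X

open scoped Classical in
/-- The demands whose target lies outside `X`. -/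
noncomputable def unmet (τ : ι → α) (X : Set α) : Finset ι :=
  Finset.univ.filter fun i => τ i ∉ X

/-- The cut condition: every set containing the root has at least as many leaving arcs as there
are targets outside it. -/
def CutCondition (tl hd : β → α) (r : α) (τ : ι → α) (S : Finset β) : Prop :=
  ∀ X : Set α, r ∈ X → (unmet τ X).card ≤ (outArcs tl hd S X).card

lemma mem_outArcs {tl hd : β → α} {S : Finset β} {X : Set α} {e : β} :
    e ∈ outArcs tl hd S X ↔ e ∈ S ∧ tl e ∈ X ∧ hd e ∉ X := by
  simp [outArcs]

lemma mem_unmet {τ : ι → α} {X : Set α} {i : ι} : i ∈ unmet τ X ↔ τ i ∉ X := by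
  simp [unmet]

lemma outArcs_erase [DecidableEq β] (tl hd : β → α) (S : Finset β) (X : Set α) (a : β) :
    outArcs tl hd (S.erase a) X = (outArcs tl hd S X).erase a := by
  ext e
  simp only [mem_outArcs, Finset.mem_erase]
  tauto

lemma card_add_card_le {γ : Type*} {A B C D : Finset γ}
    (hAC : ∀ e, e ∈ A ∨ e ∈ B → e ∈ C ∨ e ∈ D) (hBD : ∀ e, e ∈ A → e ∈ B → e ∈ C ∧ e ∈ D) :
    A.card + B.card ≤ C.card + D.card := by
  classical
  rw [← Finset.card_union_add_card_inter A B, ← Finset.card_union_add_card_inter C D]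
  refine add_le_add (Finset.card_le_card fun e he => ?_) (Finset.card_le_card fun e he => ?_)
  · simpa using hAC e (by simpa using he)
  · simp only [Finset.mem_inter] at he ⊢
    exact hBD e he.1 he.2

lemma outArcs_submodular (tl hd : β → α) (S : Finset β) (X Y : Set α) :
    (outArcs tl hd S (X ∩ Y)).card + (outArcs tl hd S (X ∪ Y)).card ≤
      (outArcs tl hd S X).card + (outArcs tl hd S Y).card := by
  apply card_add_card_le <;> intro e <;> simp only [mem_outArcs, Set.mem_inter_iff, Set.mem_union]
    <;> tauto

lemma unmet_supermodular (τ : ι → α) (X Y : Set α) :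
    (unmet τ X).card + (unmet τ Y).card ≤
      (unmet τ (X ∩ Y)).card + (unmet τ (X ∪ Y)).card := by
  apply card_add_card_le <;> intro e <;> simp only [mem_unmet, Set.mem_inter_iff, Set.mem_union]
    <;> tauto

/-- Some arc into a target `v ≠ r` has its tail in every tight set containing `r` and `v`;
otherwise an intersection `X` of tight sets avoids the tails of all arcs into `v`, and
`X \ {v}` violates the cut condition. -/
lemma exists_arc_of_cutCondition {tl hd : β → α} {r : α} {τ : ι → α} {S : Finset β}
    (h : CutCondition tl hd r τ S) {i : ι} (hi : τ i ≠ r) :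
    ∃ e ∈ S, hd e = τ i ∧ ∀ X : Set α, r ∈ X → τ i ∈ X → tl e ∉ X →
      (unmet τ X).card < (outArcs tl hd S X).card := by
  classical
  by_contra! hcon
  have key : ∀ T ⊆ S, (∀ e ∈ T, hd e = τ i) → ∃ X : Set α, r ∈ X ∧ τ i ∈ X ∧
      (outArcs tl hd S X).card ≤ (unmet τ X).card ∧ ∀ e ∈ T, tl e ∉ X := by
    intro T
    induction T using Finset.induction_on with
    | empty =>
      intro _ _
      exact ⟨Set.univ, trivial, trivial, by simp [outArcs], by simp⟩
    | insert a T ha ih =>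
      intro hS hT
      obtain ⟨X, hrX, hvX, hX, hTX⟩ :=
        ih (fun e he => hS (Finset.mem_insert_of_mem he))
          (fun e he => hT e (Finset.mem_insert_of_mem he))
      obtain ⟨Y, hrY, hvY, haY, hY⟩ :=
        hcon a (hS (Finset.mem_insert_self _ _)) (hT a (Finset.mem_insert_self _ _))
      refine ⟨X ∩ Y, ⟨hrX, hrY⟩, ⟨hvX, hvY⟩, ?_, ?_⟩
      · have h1 := outArcs_submodular tl hd S X Y
        have h2 := unmet_supermodular τ X Y
        have h3 := h (X ∪ Y) (Or.inl hrX)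
        omega
      · intro e he
        rcases Finset.mem_insert.1 he with rfl | he
        · exact fun hh => haY hh.2
        · exact fun hh => hTX e he hh.1
  obtain ⟨X, hrX, hvX, hX, hT⟩ := key (S.filter fun e => hd e = τ i) (Finset.filter_subset _ _)
    (by simp)
  have h1 := h (X \ {τ i}) ⟨hrX, fun hh => hi hh.symm⟩
  have h2 : (outArcs tl hd S (X \ {τ i})).card ≤ (outArcs tl hd S X).card := by
    refine Finset.card_le_card fun e he => ?_
    rw [mem_outArcs] at he ⊢
    refine ⟨he.1, he.2.1.1, fun hh => he.2.2 ⟨hh, fun hv => ?_⟩⟩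
    exact hT e (Finset.mem_filter.2 ⟨he.1, hv⟩) he.2.1.1
  have h3 : (unmet τ X).card < (unmet τ (X \ {τ i})).card := by
    refine Finset.card_lt_card ((Finset.ssubset_iff_of_subset fun j hj => ?_).2 ⟨i, ?_, ?_⟩)
    · rw [mem_unmet] at hj ⊢
      exact fun hh => hj hh.1
    · simp [mem_unmet]
    · simpa [mem_unmet] using hvX
  omega

/-- Arc-version of Menger's theorem with prescribed targets. The cut condition yields arc-disjoint
walks from the root, one to each target; the walk for `i` uses only the arcs in `P i`. In the
induction the last arc of a walk is split off, and the target is moved back to its tail. -/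
theorem exists_disjoint_walks {tl hd : β → α} {r : α} (S : Finset β) (τ : ι → α)
    (h : CutCondition tl hd r τ S) :
    ∃ P : ι → Set β, (∀ i, P i ⊆ S) ∧ Pairwise (fun i j => Disjoint (P i) (P j)) ∧
      ∀ i, Relation.ReflTransGen (fun a b => ∃ e ∈ P i, tl e = a ∧ hd e = b) r (τ i) := by
  classical
  induction hn : S.card generalizing S τ with
  | zero =>
    by_cases hall : ∀ i, τ i = r
    · exact ⟨fun _ => ∅, by simp, fun _ _ _ => by simp, fun i => by rw [hall i]⟩
    · push Not at hall
      obtain ⟨i, hi⟩ := hall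
      obtain ⟨e, he, -⟩ := exists_arc_of_cutCondition h hi
      simp [Finset.card_eq_zero.1 hn] at he
  | succ n ih =>
    by_cases hall : ∀ i, τ i = r
    · exact ⟨fun _ => ∅, by simp, fun _ _ _ => by simp, fun i => by rw [hall i]⟩
    push Not at hall
    obtain ⟨i, hi⟩ := hall
    obtain ⟨e, he, hev, htight⟩ := exists_arc_of_cutCondition h hi
    have h' : CutCondition tl hd r (Function.update τ i (tl e)) (S.erase e) := by
      intro X hr
      have hX := h X hr
      have hout := (outArcs tl hd S X).pred_card_le_card_erase (a := e)
      rw [← outArcs_erase] at hout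
      have hkeep : (tl e ∉ X ∨ τ i ∈ X) →
          (outArcs tl hd (S.erase e) X).card = (outArcs tl hd S X).card := by
        intro hX'
        rw [outArcs_erase, Finset.erase_eq_of_notMem]
        rw [mem_outArcs, hev]
        tauto
      have hsub : unmet (Function.update τ i (tl e)) X ⊆ insert i (unmet τ X) := by
        intro j hj
        by_cases hji : j = i
        · simp [hji]
        · refine Finset.mem_insert_of_mem ?_
          rw [mem_unmet] at hj ⊢
          simpa [hji] using hj
      have hins := (Finset.card_le_card hsub).trans (Finset.card_insert_le _ _)
      by_cases hv : τ i ∈ X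
      · rw [hkeep (Or.inr hv)]
        by_cases hu : tl e ∈ X
        · refine (Finset.card_le_card fun j hj => ?_).trans hX
          refine Finset.mem_of_mem_insert_of_ne (hsub hj) ?_
          rintro rfl
          simp [mem_unmet, hu] at hj
        · -- The only case where the demand grows; tight sets of this kind are excluded.
          have := htight X hr hv hu
          omega
      · rw [Finset.insert_eq_of_mem (mem_unmet.2 hv)] at hsub
        by_cases hu : tl e ∈ X
        · have hlt := Finset.card_lt_card ((Finset.ssubset_iff_of_subset hsub).2
            ⟨i, mem_unmet.2 hv, by simpa [mem_unmet] using hu⟩)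
          omega
        · rw [hkeep (Or.inl hu)]
          exact (Finset.card_le_card hsub).trans hX
    obtain ⟨P, hPS, hPd, hP⟩ := ih (S.erase e) _ h' (by rw [Finset.card_erase_of_mem he]; omega)
    have heP : ∀ j, e ∉ P j := fun j hj => by simpa using hPS j hj
    refine ⟨Function.update P i (insert e (P i)), fun j => ?_, fun j k hjk => ?_, fun j => ?_⟩
    · have hj : P j ⊆ S := fun a ha => Finset.mem_of_mem_erase (hPS j ha)
      by_cases hji : j = i
      · subst hji
        simpa using Set.insert_subset (by simpa using he) hj
      · simpa [hji] using hj
    · by_cases hji : j = i <;> by_cases hki : k = i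
      · exact absurd (hji.trans hki.symm) hjk
      · subst hji
        simpa [hki, heP] using hPd hjk
      · subst hki
        simpa [hji, heP] using hPd hjk
      · simpa [hji, hki] using hPd hjk
    · by_cases hji : j = i
      · subst hji
        have hj := hP j
        simp only [Function.update_self] at hj ⊢
        refine Relation.ReflTransGen.tail (b := tl e) (Relation.ReflTransGen.mono ?_ _ _ hj) ⟨e, by simp, rfl, hev⟩
        rintro a b ⟨f, hf, hab⟩
        exact ⟨f, Set.mem_insert_of_mem _ hf, hab⟩
      · simpa [hji] using hP j

/-- An inclusion-minimal arc set satisfying the cut condition contains no two antiparallel arcs: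
by minimality each of them leaves a tight set, and uncrossing these two tight sets
gains both arcs. -/
lemma not_antiparallel_of_minimal {tl hd : β → α} {r : α} {τ : ι → α} {S : Finset β}
    (h : Minimal (CutCondition tl hd r τ) S) {e f : β} (he : e ∈ S) (hf : f ∈ S) :
    ¬ (tl e = hd f ∧ hd e = tl f) := by
  classical
  rintro ⟨h1, h2⟩
  have key : ∀ a ∈ S, ∃ X : Set α, r ∈ X ∧ tl a ∈ X ∧ hd a ∉ X ∧
      (outArcs tl hd (S.erase a) X).card < (unmet τ X).card := by
    intro a ha
    have hn : ¬ CutCondition tl hd r τ (S.erase a) := fun hc =>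
      Finset.notMem_erase a S (h.2 hc (Finset.erase_subset _ _) ha)
    simp only [CutCondition, not_forall, not_le] at hn
    obtain ⟨X, hr, hX⟩ := hn
    have hleave : a ∈ outArcs tl hd S X := by
      by_contra hna
      rw [outArcs_erase, Finset.erase_eq_of_notMem hna] at hX
      exact absurd (h.1 X hr) (not_le.2 hX)
    rw [mem_outArcs] at hleave
    exact ⟨X, hr, hleave.2.1, hleave.2.2, hX⟩
  obtain ⟨X, hrX, heX, heX', hX⟩ := key e he
  obtain ⟨Y, hrY, hfY, hfY', hY⟩ := key f hf
  have hsub := outArcs_submodular tl hd ((S.erase e).erase f) X Y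
  have hXle : (outArcs tl hd ((S.erase e).erase f) X).card ≤
      (outArcs tl hd (S.erase e) X).card :=
    Finset.card_le_card fun a ha => by
      rw [mem_outArcs] at ha ⊢
      exact ⟨Finset.mem_of_mem_erase ha.1, ha.2⟩
  have hYle : (outArcs tl hd ((S.erase e).erase f) Y).card ≤
      (outArcs tl hd (S.erase f) Y).card :=
    Finset.card_le_card fun a ha => by
      rw [mem_outArcs] at ha ⊢
      simp only [Finset.mem_erase] at ha ⊢
      tauto
  have hinter := h.1 (X ∩ Y) ⟨hrX, hrY⟩
  have hunion := h.1 (X ∪ Y) (Or.inl hrX)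
  have hinterle : (outArcs tl hd S (X ∩ Y)).card ≤
      (outArcs tl hd ((S.erase e).erase f) (X ∩ Y)).card :=
    Finset.card_le_card fun a ha => by
      rw [mem_outArcs] at ha ⊢
      simp only [Finset.mem_erase]
      refine ⟨⟨?_, ?_, ha.1⟩, ha.2⟩
      · rintro rfl; exact heX' (h2 ▸ ha.2.1.1)
      · rintro rfl; exact hfY' (h1 ▸ ha.2.1.2)
  have hunionle : (outArcs tl hd S (X ∪ Y)).card ≤
      (outArcs tl hd ((S.erase e).erase f) (X ∪ Y)).card :=
    Finset.card_le_card fun a ha => by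
      rw [mem_outArcs] at ha ⊢
      simp only [Finset.mem_erase]
      refine ⟨⟨?_, ?_, ha.1⟩, ha.2⟩
      · rintro rfl; exact ha.2.2 (Or.inl (h1 ▸ heX))
      · rintro rfl; exact ha.2.2 (Or.inr (h2 ▸ hfY))
  have hmod := unmet_supermodular τ X Y
  omega

end ArcMenger

/-! ### Laminar families of small cuts -/

namespace Graph

variable {α β : Type*} {G : Graph α β}

/-- The subsets `X`, `Y` of a ground set `V` are nested as bipartitions of `V`: one of the four
quadrants determined by them is empty. Unlike `Graph.Uncrossed`, this ignores components. -/
def Nested (V X Y : Set α) : Prop :=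
  (∀ a ∈ V, a ∈ X → a ∉ Y) ∨ (∀ a ∈ V, a ∈ X → a ∈ Y) ∨
    (∀ a ∈ V, a ∈ Y → a ∈ X) ∨ (∀ a ∈ V, a ∉ X → a ∈ Y)

lemma Nested.symm {V X Y : Set α} (h : Nested V X Y) : Nested V Y X := by
  unfold Nested at *
  rcases h with h | h | h | h
  · exact Or.inl fun a ha hY hX => h a ha hX hY
  · exact Or.inr (Or.inr (Or.inl h))
  · exact Or.inr (Or.inl h)
  · exact Or.inr (Or.inr (Or.inr fun a ha hY => by_contra fun hX => hY (h a ha hX)))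

lemma Nested.compl {V X Y : Set α} (h : Nested V X Y) : Nested V (V \ X) Y := by
  unfold Nested at *
  rcases h with h | h | h | h
  · exact Or.inr (Or.inr (Or.inl fun a ha hY => ⟨ha, fun hX => h a ha hX hY⟩))
  · exact Or.inr (Or.inr (Or.inr fun a ha hX => h a ha (by simpa [ha] using hX)))
  · exact Or.inl fun a ha hX hY => hX.2 (h a ha hY)
  · exact Or.inr (Or.inl fun a ha hX => h a ha hX.2)

lemma Nested.of_compl {V X Y : Set α} (hX : X ⊆ V) (h : Nested V (V \ X) Y) : Nested V X Y := by
  simpa [Set.inter_eq_self_of_subset_right hX] using h.compl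

lemma componentOf_subset (c : α) (hc : c ∈ V(G)) : G.componentOf c ⊆ V(G) := by
  rintro y ⟨w⟩
  induction w with
  | nil hx => exact hx
  | cons e h w ih => exact ih h.right_mem

lemma Nested.uncrossed {X Y : Set α} (h : Nested V(G) X Y) : G.Uncrossed X Y := by
  intro c hc
  have hC := componentOf_subset (G := G) c hc
  rcases h with h | h | h | h
  · exact Or.inr (Or.inl fun a ha => ⟨ha.2, h a (hC ha.2) ha.1⟩)
  · exact Or.inl fun a ha => ⟨h a (hC ha.2) ha.1, ha.2⟩
  · exact Or.inr (Or.inr (Or.inr fun a ha => ⟨ha.1, fun hY => ha.2 (h a (hC ha.1) hY)⟩))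
  · exact Or.inr (Or.inr (Or.inl fun a ha => ⟨h a (hC ha.1) ha.2, ha.1⟩))

/-- Uncrossing creates no new crossings: a set nested with two crossing sets `X` and `Y` is nested
with their union and differences. The four points witnessing that `X` and `Y` cross rule out the
mixed cases. -/
lemma Nested.union_sdiff {V X Y Z : Set α} (hXY : ¬ Nested V X Y) (hX : Nested V Z X)
    (hY : Nested V Z Y) : Nested V Z (Y ∪ X) ∧ Nested V Z (Y \ X) := by
  simp only [Nested, not_or, not_forall] at hXY
  obtain ⟨⟨a, ha⟩, ⟨b, hb⟩, ⟨c, hc⟩, ⟨d, hd⟩⟩ := hXY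
  simp only [Nested, Set.mem_union, Set.mem_sdiff] at *
  constructor
  · rcases hX with hX | hX | hX | hX <;> rcases hY with hY | hY | hY | hY <;> grind
  · rcases hX with hX | hX | hX | hX <;> rcases hY with hY | hY | hY | hY <;> grind

lemma IsLink.mem_edgeCut_iff {e : β} {a b : α} (h : G.IsLink e a b) (X : Set α) :
    e ∈ G.edgeCut X ↔ (a ∈ X ∧ b ∉ X) ∨ (b ∈ X ∧ a ∉ X) := by
  constructor
  · rintro ⟨x, hx, y, hy, hxy⟩
    rcases h.eq_and_eq_or_eq_and_eq hxy with ⟨rfl, rfl⟩ | ⟨rfl, rfl⟩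
    · exact Or.inl ⟨hx, hy.2⟩
    · exact Or.inr ⟨hx, hy.2⟩
  · rintro (⟨ha, hb⟩ | ⟨hb, ha⟩)
    · exact ⟨a, ha, b, ⟨h.right_mem, hb⟩, h⟩
    · exact ⟨b, hb, a, ⟨h.left_mem, ha⟩, h.symm⟩

lemma edgeCut_subset (X : Set α) : G.edgeCut X ⊆ E(G) := by
  rintro e ⟨x, -, y, -, h⟩
  exact h.edge_mem

lemma edgeCut_compl (X : Set α) : G.edgeCut (V(G) \ X) = G.edgeCut X := by
  ext e
  by_cases he : e ∈ E(G)
  · obtain ⟨a, b, h⟩ := exists_isLink_of_mem_edgeSet he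
    have := h.left_mem
    have := h.right_mem
    simp only [h.mem_edgeCut_iff, Set.mem_sdiff]
    tauto
  · exact iff_of_false (fun h => he (edgeCut_subset _ h)) fun h => he (edgeCut_subset _ h)

lemma ncard_add_ncard_le {A B C D : Set β} (hE : E(G).Finite)
    (hA : A ⊆ E(G)) (hB : B ⊆ E(G)) (hC : C ⊆ E(G)) (hD : D ⊆ E(G))
    (hu : ∀ e a b, G.IsLink e a b → (e ∈ A ∨ e ∈ B) → (e ∈ C ∨ e ∈ D))
    (hi : ∀ e a b, G.IsLink e a b → (e ∈ A ∧ e ∈ B) → (e ∈ C ∧ e ∈ D)) :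
    A.ncard + B.ncard ≤ C.ncard + D.ncard := by
  rw [← Set.ncard_union_add_ncard_inter A B (hE.subset hA) (hE.subset hB),
    ← Set.ncard_union_add_ncard_inter C D (hE.subset hC) (hE.subset hD)]
  refine add_le_add (Set.ncard_le_ncard (fun e he => ?_)
    (hE.subset (Set.union_subset hC hD))) (Set.ncard_le_ncard (fun e he => ?_)
    (hE.subset (Set.inter_subset_left.trans hC)))
  · obtain ⟨a, b, h⟩ := exists_isLink_of_mem_edgeSet (Set.union_subset hA hB he)
    exact hu e a b h he
  · obtain ⟨a, b, h⟩ := exists_isLink_of_mem_edgeSet (hA he.1)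
    exact hi e a b h he

lemma edgeCut_submodular (hE : E(G).Finite) (X Y : Set α) :
    (G.edgeCut (X ∩ Y)).ncard + (G.edgeCut (Y ∪ X)).ncard ≤
      (G.edgeCut X).ncard + (G.edgeCut Y).ncard := by
  apply ncard_add_ncard_le hE <;> try exact edgeCut_subset _
  all_goals
    intro e a b h
    simp only [h.mem_edgeCut_iff, Set.mem_inter_iff, Set.mem_union]
    tauto

lemma edgeCut_posimodular (hE : E(G).Finite) (X Y : Set α) :
    (G.edgeCut (X \ Y)).ncard + (G.edgeCut (Y \ X)).ncard ≤
      (G.edgeCut X).ncard + (G.edgeCut Y).ncard := by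
  apply ncard_add_ncard_le hE <;> try exact edgeCut_subset _
  all_goals
    intro e a b h
    simp only [h.mem_edgeCut_iff, Set.mem_sdiff]
    tauto

/-- `X` is one side of a minimum edge-cut separating some pair of vertices. -/
def IsMinCut (G : Graph α β) (X : Set α) : Prop :=
  ∃ s ∈ V(G), ∃ t ∈ V(G), ¬ (s ∈ X ↔ t ∈ X) ∧
    ∀ Z ⊆ V(G), ¬ (s ∈ Z ↔ t ∈ Z) → (G.edgeCut X).ncard ≤ (G.edgeCut Z).ncard

lemma IsMinCut.compl {X : Set α} (h : G.IsMinCut X) : G.IsMinCut (V(G) \ X) := by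
  obtain ⟨s, hs, t, ht, hst, hmin⟩ := h
  refine ⟨s, hs, t, ht, ?_, by rwa [edgeCut_compl]⟩
  simp only [Set.mem_sdiff, hs, ht, true_and]
  tauto

/-- The Gomory–Hu uncrossing step: if both `u` and `v` lie outside the minimum cut `X`, then a cut
`Y` separating them can be replaced by `Y ∪ X` or `Y \ X` without increasing its size, because
`X ∩ Y` or `X \ Y` separates the pair for which `X` is minimum. -/
lemma IsMinCut.exists_nested_of_notMem (hE : E(G).Finite) {X Y : Set α} {u v : α}
    (hXV : X ⊆ V(G)) (hX : G.IsMinCut X) (hu : u ∉ X) (hv : v ∉ X) (hYV : Y ⊆ V(G))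
    (hY : ¬ (u ∈ Y ↔ v ∈ Y)) (hXY : ¬ Nested V(G) X Y) :
    ∃ Y' ⊆ V(G), ¬ (u ∈ Y' ↔ v ∈ Y') ∧ (G.edgeCut Y').ncard ≤ (G.edgeCut Y).ncard ∧
      Nested V(G) X Y' ∧ ∀ Z, Nested V(G) Z X → Nested V(G) Z Y → Nested V(G) Z Y' := by
  obtain ⟨s, hs, t, ht, hst, hmin⟩ := hX
  wlog hsX : s ∈ X generalizing s t
  · exact this t ht s hs (fun h => hst h.symm) (fun Z hZ hts => hmin Z hZ fun h => hts h.symm)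
      (by tauto)
  have htX : t ∉ X := fun h => hst (iff_of_true hsX h)
  by_cases hsY : s ∈ Y
  · refine ⟨Y ∪ X, Set.union_subset hYV hXV, by simpa [hu, hv] using hY, ?_,
      Or.inr (Or.inl fun a _ ha => Or.inr ha), fun Z h1 h2 => (h1.union_sdiff hXY h2).1⟩
    have h1 := edgeCut_submodular hE X Y
    have h2 := hmin (X ∩ Y) (Set.inter_subset_left.trans hXV) (by simp [hsX, hsY, htX])
    omega
  · refine ⟨Y \ X, Set.sdiff_subset.trans hYV, by simpa [hu, hv] using hY, ?_,
      Or.inl fun a _ ha h => h.2 ha, fun Z h1 h2 => (h1.union_sdiff hXY h2).2⟩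
    have h1 := edgeCut_posimodular hE X Y
    have h2 := hmin (X \ Y) (Set.sdiff_subset.trans hXV) (by simp [hsX, hsY, htX])
    omega

/-- The uncrossing step for `u` and `v` on the same side of `X`; if this side is `X` itself, the
complement of `X` is used. -/
lemma IsMinCut.exists_nested (hE : E(G).Finite) {X Y : Set α} {u v : α}
    (hXV : X ⊆ V(G)) (hX : G.IsMinCut X) (huv : u ∈ X ↔ v ∈ X) (hYV : Y ⊆ V(G))
    (hY : ¬ (u ∈ Y ↔ v ∈ Y)) (hXY : ¬ Nested V(G) X Y) :
    ∃ Y' ⊆ V(G), ¬ (u ∈ Y' ↔ v ∈ Y') ∧ (G.edgeCut Y').ncard ≤ (G.edgeCut Y).ncard ∧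
      Nested V(G) X Y' ∧ ∀ Z, Nested V(G) Z X → Nested V(G) Z Y → Nested V(G) Z Y' := by
  by_cases huX : u ∈ X
  · obtain ⟨Y', h1, h2, h3, h4, h5⟩ := hX.compl.exists_nested_of_notMem hE Set.sdiff_subset
      (fun h => h.2 huX) (fun h => h.2 (huv.1 huX)) hYV hY fun h => hXY (h.of_compl hXV)
    exact ⟨Y', h1, h2, h3, h4.of_compl hXV, fun Z hZ => h5 Z hZ.symm.compl.symm⟩
  · exact hX.exists_nested_of_notMem hE hXV huX (fun h => huX (huv.2 h)) hYV hY hXY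

/-- There is a nested family of cuts of size less than `k` that separates any two vertices
separated by some cut of size less than `k`. A maximal nested family of minimum cuts has this
property: if it fails to separate `u` and `v`, then a minimum `u`-`v` cut crossing as few members
as possible crosses none of them, so that it can be added. -/
theorem exists_nested_family (hV : V(G).Finite) (hE : E(G).Finite) (k : ℕ) :
    ∃ F : Set (Set α), (∀ X ∈ F, X ⊆ V(G)) ∧ (∀ X ∈ F, (G.edgeCut X).ncard < k) ∧
      F.Pairwise (Nested V(G)) ∧
      ∀ u ∈ V(G), ∀ v ∈ V(G), (∀ X ∈ F, (u ∈ X ↔ v ∈ X)) →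
        ∀ X ⊆ V(G), ¬ (u ∈ X ↔ v ∈ X) → k ≤ (G.edgeCut X).ncard := by
  let good : Set (Set (Set α)) := {F | F ⊆ V(G).powerset ∧ (∀ X ∈ F, (G.edgeCut X).ncard < k) ∧
    (∀ X ∈ F, G.IsMinCut X) ∧ F.Pairwise (Nested V(G))}
  have hfin : good.Finite := hV.finite_subsets.finite_subsets.subset fun F hF => hF.1
  obtain ⟨F, ⟨hFV, hFk, hFmin, hFn⟩, hFmax⟩ :=
    hfin.exists_maximal ⟨∅, by simp, by simp, by simp, by simp⟩
  have hFfin : F.Finite := hV.finite_subsets.subset hFV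
  refine ⟨F, hFV, hFk, hFn, fun u hu v hv huv X hXV hX => ?_⟩
  by_contra! hk
  obtain ⟨Y₀, ⟨hY₀V, hY₀⟩, hmin⟩ := (InvImage.wf (fun Y => (G.edgeCut Y).ncard)
    wellFounded_lt).has_min {Y | Y ⊆ V(G) ∧ ¬ (u ∈ Y ↔ v ∈ Y)} ⟨X, hXV, hX⟩
  simp only [InvImage, not_lt] at hmin
  obtain ⟨Y, ⟨hYV, hY, hYle⟩, hcross⟩ := (InvImage.wf (fun Y => {Z ∈ F | ¬ Nested V(G) Z Y}.ncard)
    wellFounded_lt).has_min {Y | Y ⊆ V(G) ∧ ¬ (u ∈ Y ↔ v ∈ Y) ∧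
      (G.edgeCut Y).ncard ≤ (G.edgeCut Y₀).ncard} ⟨Y₀, hY₀V, hY₀, le_rfl⟩
  simp only [InvImage, not_lt] at hcross
  have hYF : ∀ Z ∈ F, Nested V(G) Z Y := by
    by_contra! hex
    obtain ⟨Z, hZ, hZY⟩ := hex
    obtain ⟨Y', h1, h2, h3, h4, h5⟩ :=
      (hFmin Z hZ).exists_nested hE (hFV hZ) (huv Z hZ) hYV hY hZY
    have hfinY : {Z ∈ F | ¬ Nested V(G) Z Y}.Finite := hFfin.subset fun _ h => h.1
    have hsub : {W ∈ F | ¬ Nested V(G) W Y'} ⊆ {W ∈ F | ¬ Nested V(G) W Y} := by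
      rintro W ⟨hW, hWY'⟩
      refine ⟨hW, fun hWY => hWY' ?_⟩
      by_cases hWZ : W = Z
      · exact hWZ ▸ h4
      · exact h5 W (hFn hW hZ hWZ) hWY
    have hlt := Set.ncard_lt_ncard ((Set.ssubset_iff_of_subset hsub).2
      ⟨Z, ⟨hZ, hZY⟩, fun h => h.2 h4⟩) hfinY
    exact absurd (hcross Y' ⟨h1, h2, h3.trans hYle⟩) (not_le.2 hlt)
  have hins : insert Y F ∈ good := by
    refine ⟨Set.insert_subset hYV hFV, ?_, ?_, ?_⟩
    · rintro Z (rfl | hZ)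
      · exact (hYle.trans (hmin X ⟨hXV, hX⟩)).trans_lt hk
      · exact hFk Z hZ
    · rintro Z (rfl | hZ)
      · exact ⟨u, hu, v, hv, hY, fun W hW huvW => hYle.trans (hmin W ⟨hW, huvW⟩)⟩
      · exact hFmin Z hZ
    · exact hFn.insert fun Z hZ _ => ⟨(hYF Z hZ).symm, hYF Z hZ⟩
  exact hY (huv Y (hFmax hins (Set.subset_insert _ _) (Set.mem_insert _ _)))

end Graph

/-! ### Edge-disjoint paths from a root in a graph -/

namespace Graph

variable {α β : Type*} {G : Graph α β}

/-- `a` and `b` are joined by an edge of `G` that belongs to `Q`. -/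
def LinkedIn (G : Graph α β) (Q : Set β) (a b : α) : Prop :=
  ∃ e ∈ Q, G.IsLink e a b

lemma LinkedIn.symm {Q : Set β} {a b : α} (h : G.LinkedIn Q a b) : G.LinkedIn Q b a := by
  obtain ⟨e, he, h⟩ := h
  exact ⟨e, he, h.symm⟩

/-- Edge-version of Menger's theorem with prescribed targets: if for every set `X` containing the
root the cut `δ(X)` has at least as many edges as there are targets outside `X`, then the root is
connected to all targets within pairwise disjoint edge sets. Every edge is replaced by its two
orientations; as a minimal arc set satisfying the cut condition uses at most one of them,
arc-disjoint walks in it are edge-disjoint in `G`. -/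
theorem exists_disjoint_connections {ι : Type*} [Fintype ι] (hV : V(G).Finite) (hE : E(G).Finite)
    {r : α} (τ : ι → α)
    (h : ∀ X : Set α, r ∈ X → (ArcMenger.unmet τ X).card ≤ (G.edgeCut X).ncard) :
    ∃ Q : ι → Set β, Pairwise (fun i j => Disjoint (Q i) (Q j)) ∧
      ∀ i, Relation.ReflTransGen (G.LinkedIn (Q i)) r (τ i) := by
  classical
  let tl : β × α × α → α := fun a => a.2.1
  let hd : β × α × α → α := fun a => a.2.2
  have hfin : {a : β × α × α | G.IsLink a.1 a.2.1 a.2.2}.Finite :=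
    (hE.prod (hV.prod hV)).subset fun a ha => ⟨ha.edge_mem, ha.left_mem, ha.right_mem⟩
  have hcond : ArcMenger.CutCondition tl hd r τ hfin.toFinset := by
    intro X hr
    have hsub : G.edgeCut X ⊆ (ArcMenger.outArcs tl hd hfin.toFinset X).image Prod.fst := by
      rintro e ⟨x, hx, y, hy, hxy⟩
      exact Finset.mem_coe.2 (Finset.mem_image.2
        ⟨(e, x, y), by simpa [ArcMenger.mem_outArcs, tl, hd] using ⟨hxy, hx, hy.2⟩, rfl⟩)
    have hle := Set.ncard_le_ncard hsub (Finset.finite_toSet _)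
    rw [Set.ncard_coe_finset] at hle
    exact (h X hr).trans (hle.trans Finset.card_image_le)
  obtain ⟨S, hS, hSmin⟩ := exists_minimal_le_of_wellFoundedLT _ _ hcond
  have hlink : ∀ a ∈ S, G.IsLink a.1 a.2.1 a.2.2 := fun a ha => by simpa using hS ha
  have hinj : ∀ a ∈ S, ∀ b ∈ S, a.1 = b.1 → a = b := by
    intro a ha b hb hab
    have hb' := hlink b hb
    rw [← hab] at hb'
    rcases (hlink a ha).eq_and_eq_or_eq_and_eq hb' with h1 | h1
    · exact Prod.ext hab (Prod.ext h1.1 h1.2)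
    · exact absurd h1 (ArcMenger.not_antiparallel_of_minimal hSmin ha hb)
  obtain ⟨P, hPS, hPd, hP⟩ := ArcMenger.exists_disjoint_walks S τ hSmin.1
  refine ⟨fun i => Prod.fst '' P i, fun i j hij => ?_, fun i =>
    Relation.ReflTransGen.mono ?_ _ _ (hP i)⟩
  · refine Set.disjoint_left.2 ?_
    rintro _ ⟨a, ha, rfl⟩ ⟨b, hb, hab⟩
    have := hinj b (hPS j hb) a (hPS i ha) hab
    exact Set.disjoint_left.1 (hPd hij) ha (this ▸ hb)
  · rintro _ _ ⟨a, ha, rfl, rfl⟩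
    exact ⟨a.1, ⟨a, ha, rfl⟩, hlink a (hPS i ha)⟩

lemma Walk.exists_suffix {x y z : α} (w : G.Walk x y) (hw : w.IsPath) (hz : z ∈ w.support) :
    ∃ w' : G.Walk z y, w'.IsPath ∧ ∀ e ∈ w'.edges, e ∈ w.edges := by
  induction w with
  | nil hx =>
    obtain rfl : z = _ := by simpa [Walk.support] using hz
    exact ⟨.nil hx, hw, fun _ h => h⟩
  | @cons a b c e h w ih =>
    rcases List.mem_cons.1 hz with rfl | hz
    · exact ⟨.cons e h w, hw, fun _ h => h⟩
    · obtain ⟨w', h1, h2⟩ := ih (List.nodup_cons.1 hw).2 hz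
      exact ⟨w', h1, fun f hf => List.mem_cons_of_mem _ (h2 f hf)⟩

lemma exists_isPathEdgeSet_subset {Q : Set β} {x y : α} (hy : y ∈ V(G))
    (h : Relation.ReflTransGen (G.LinkedIn Q) x y) :
    ∃ S ⊆ Q, G.IsPathEdgeSet x y S := by
  suffices ∃ w : G.Walk x y, w.IsPath ∧ ∀ e ∈ w.edges, e ∈ Q by
    obtain ⟨w, hw, hwQ⟩ := this
    exact ⟨{f | f ∈ w.edges}, hwQ, w, hw, rfl⟩
  induction h using Relation.ReflTransGen.head_induction_on with
  | refl => exact ⟨.nil hy, by simp [Walk.IsPath, Walk.support], by simp [Walk.edges]⟩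
  | @head a b hab _ ih =>
    obtain ⟨w, hw, hwQ⟩ := ih
    obtain ⟨e, he, hab⟩ := hab
    by_cases ha : a ∈ w.support
    · obtain ⟨w', h1, h2⟩ := w.exists_suffix hw ha
      exact ⟨w', h1, fun f hf => hwQ f (h2 f hf)⟩
    · refine ⟨.cons e hab w, List.nodup_cons.2 ⟨ha, hw⟩, fun f hf => ?_⟩
      rcases List.mem_cons.1 hf with rfl | hf
      · exact he
      · exact hwQ f hf

lemma Walk.exists_concat {x y z : α} (w : G.Walk x y) (e : β) (h : G.IsLink e y z) :
    ∃ w' : G.Walk x z, w'.support = w.support ++ [z] ∧ w'.edges = w.edges ++ [e] := by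
  induction w with
  | nil hx => exact ⟨.cons e h (.nil h.right_mem), rfl, rfl⟩
  | cons f hf w ih =>
    obtain ⟨w', h1, h2⟩ := ih h
    exact ⟨.cons f hf w', by simp [Walk.support, h1], by simp [Walk.edges, h2]⟩

lemma Walk.exists_reverse {x y : α} (w : G.Walk x y) :
    ∃ w' : G.Walk y x, w'.support = w.support.reverse ∧ w'.edges = w.edges.reverse := by
  induction w with
  | nil hx => exact ⟨.nil hx, rfl, rfl⟩
  | cons e h w ih =>
    obtain ⟨w₁, h1, h2⟩ := ih
    obtain ⟨w₂, h3, h4⟩ := w₁.exists_concat e h.symm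
    exact ⟨w₂, by simp [Walk.support, h3, h1], by simp [Walk.edges, h4, h2]⟩

lemma IsPathEdgeSet.symm {x y : α} {S : Set β} (h : G.IsPathEdgeSet x y S) :
    G.IsPathEdgeSet y x S := by
  obtain ⟨w, hw, rfl⟩ := h
  obtain ⟨w', h1, h2⟩ := w.exists_reverse
  exact ⟨w', by simpa [Walk.IsPath, h1] using hw, by simp [h2]⟩

/-! ### Immersions of complete graphs -/

/-- For an immersion it suffices to connect the pairs within pairwise disjoint edge sets. -/
lemma hasImmersion_of_disjoint_connections {γ : Type*} {H : SimpleGraph γ} {φ : γ → α}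
    (hφ : Function.Injective φ) (hφV : ∀ v, φ v ∈ V(G)) (R : Sym2 γ → Set β)
    (hR : H.edgeSet.PairwiseDisjoint R)
    (hconn : ∀ u v, H.Adj u v → Relation.ReflTransGen (G.LinkedIn (R s(u, v))) (φ u) (φ v)) :
    G.HasImmersion H := by
  have key : ∀ z : Sym2 γ, ∃ S ⊆ R z, ∀ u v, z = s(u, v) → H.Adj u v →
      G.IsPathEdgeSet (φ u) (φ v) S := by
    intro z
    induction z using Sym2.ind with
    | _ u v =>
      by_cases huv : H.Adj u v
      · obtain ⟨S, hS, hp⟩ := exists_isPathEdgeSet_subset (hφV v) (hconn u v huv)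
        refine ⟨S, hS, fun a b hab _ => ?_⟩
        rcases Sym2.eq_iff.1 hab with ⟨rfl, rfl⟩ | ⟨rfl, rfl⟩
        · exact hp
        · exact hp.symm
      · refine ⟨∅, Set.empty_subset _, fun a b hab hadj => absurd ?_ huv⟩
        rcases Sym2.eq_iff.1 hab with ⟨rfl, rfl⟩ | ⟨rfl, rfl⟩
        · exact hadj
        · exact hadj.symm
  choose P hPR hP using key
  exact ⟨φ, hφ, hφV, P, fun u v huv => hP _ u v rfl huv,
    fun a ha b hb hab => (hR ha hb hab).mono (hPR a) (hPR b)⟩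

/-- If `t` vertices are pairwise not separated by cuts of size less than `(t - 1) ^ 2`, then they
are the branch vertices of an immersion of `K_t`. A root `φ r` is connected to every other `φ i` by
`t - 1` paths, one for each `j ≠ i`, all edge-disjoint; the path for `(i, j)` and the
path for `(j, i)` together connect `φ i` and `φ j`. -/
theorem hasImmersion_top (hV : V(G).Finite) (hE : E(G).Finite) {t : ℕ} (φ : Fin t → α)
    (hφ : Function.Injective φ) (hφV : ∀ i, φ i ∈ V(G))
    (hcut : ∀ i j, ∀ X : Set α, φ i ∈ X → φ j ∉ X → (t - 1) ^ 2 ≤ (G.edgeCut X).ncard) :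
    G.HasImmersion (⊤ : SimpleGraph (Fin t)) := by
  classical
  rcases isEmpty_or_nonempty (Fin t) with hemp | ⟨⟨r⟩⟩
  · exact ⟨φ, hφ, hφV, fun _ => ∅, fun u => hemp.elim u, fun _ _ _ _ _ => disjoint_bot_left⟩
  let ι := {p : Fin t × Fin t // p.1 ≠ p.2}
  obtain ⟨Q, hQd, hQ⟩ := exists_disjoint_connections hV hE (r := φ r) (fun p : ι => φ p.1.1) (by
    intro X hr
    by_cases hall : ∀ i, φ i ∈ X
    · simp [ArcMenger.unmet, hall]
    · push Not at hall
      obtain ⟨i, hi⟩ := hall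
      refine le_trans ?_ (hcut r i X hr hi)
      -- There are `t - 1` demands for each of the at most `t - 1` targets outside `X`.
      calc (ArcMenger.unmet (fun p : ι => φ p.1.1) X).card
          ≤ ((Finset.univ.erase r).sigma fun i : Fin t => Finset.univ.erase i).card := by
            refine Finset.card_le_card_of_injOn (fun p => ⟨p.1.1, p.1.2⟩) (fun p hp => ?_) ?_
            · have hp : φ p.1.1 ∉ X := by simpa [ArcMenger.mem_unmet] using hp
              have hpr : p.1.1 ≠ r := by intro h; exact hp (h ▸ hr)
              simpa [hpr] using p.2.symm
            · rintro ⟨⟨a, b⟩, _⟩ - ⟨⟨c, d⟩, _⟩ - h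
              exact Subtype.ext (by simpa using h)
        _ = (t - 1) ^ 2 := by
            simp [Finset.card_sigma, Finset.card_erase_of_mem, sq])
  refine hasImmersion_of_disjoint_connections hφ hφV
    (fun z => {e | ∃ p : ι, s(p.1.1, p.1.2) = z ∧ e ∈ Q p}) ?_ ?_
  · intro a _ b _ hab
    refine Set.disjoint_left.2 ?_
    rintro e ⟨p, rfl, hp⟩ ⟨q, rfl, hq⟩
    exact Set.disjoint_left.1 (hQd (i := p) (j := q) fun h => hab (by rw [h])) hp hq
  · intro u v huv
    have h1 := hQ ⟨(u, v), huv⟩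
    have h2 := hQ ⟨(v, u), fun h => huv h.symm⟩
    refine Relation.ReflTransGen.trans (b := φ r) ?_ ?_
    · refine Relation.ReflTransGen.mono ?_ _ _ (Relation.ReflTransGen.swap _ _ h1)
      rintro a b ⟨e, he, h⟩
      exact ⟨e, ⟨_, rfl, he⟩, h.symm⟩
    · refine Relation.ReflTransGen.mono ?_ _ _ h2
      rintro a b ⟨e, he, h⟩
      exact ⟨e, ⟨_, Sym2.eq_swap, he⟩, h⟩

end Graph

theorem theorem1 {α β : Type*} (G : Graph α β) (hV : V(G).Finite) (hE : E(G).Finite)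
    (t : ℕ) (hG : ¬ G.HasImmersion (⊤ : SimpleGraph (Fin t))) :
    ∃ F : Set (Set α), G.IsLaminarCutFamily F ∧
      (∀ X ∈ F, (G.edgeCut X).ncard < (t - 1) ^ 2) ∧
      (∀ B ∈ G.cutBlocks F, B.ncard < t) := by
  obtain ⟨F, hFV, hFk, hFn, hsep⟩ := Graph.exists_nested_family hV hE ((t - 1) ^ 2)
  refine ⟨F, ⟨hFV, fun X hX Y hY hXY => (hFn hX hY hXY).uncrossed⟩, hFk, ?_⟩
  rintro _ ⟨x, -, rfl⟩
  by_contra! hcard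
  obtain ⟨B, hB, hBt⟩ := Set.exists_subset_card_eq hcard
  have hBfin : B.Finite := hV.subset fun y hy => (hB hy).1
  have : Finite B := hBfin
  let φ : Fin t ≃ B := (finCongr hBt.symm).trans (Finite.equivFin B).symm
  refine hG (Graph.hasImmersion_top hV hE (fun i => (φ i : α))
    (Subtype.val_injective.comp φ.injective) (fun i => (hB (φ i).2).1) fun i j X hi hj => ?_)
  obtain ⟨hiV, hi'⟩ := hB (φ i).2
  obtain ⟨hjV, hj'⟩ := hB (φ j).2
  have h := hsep _ hiV _ hjV (fun Y hY => (hi' Y hY).symm.trans (hj' Y hY)) (X ∩ V(G))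
    Set.inter_subset_right (by simp [hi, hj, hiV])
  refine h.trans (Set.ncard_le_ncard ?_ (hE.subset (Graph.edgeCut_subset _)))
  rintro e ⟨a, ha, b, hb, hab⟩
  exact ⟨a, ha.1, b, ⟨hb.1, fun hbX => hb.2 ⟨hbX, hb.1⟩⟩, hab⟩
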